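/- Let $\mathbb K$ be a field of characteristic $0$ and let $H_{CK}$ be the Connes–Kreimer Hopf algebra of rooted trees over $\mathbb K$: the polynomial algebra on finite non-plane rooted trees, with $\Delta(T)=T\otimes 1+1\otimes T+\sum_{c}P^c(T)\otimes R^c(T)$, where $c$ runs over the non-empty admissible cuts of $T$, $P^c(T)$ is the forest cut off and $R^c(T)$ the remaining tree containing the root. Let $\phi:H_{CK}\to\mathbb K[L]$ be a Hopf algebra morphism ($L$ primitive). Let $t_0=1$ and, for $n\ge 1$, let $t_n=\sum_{|T|=n}a_T\,T$ be a nonzero linear combination of trees with $n$ vertices, such that the algebra generated by the $t_n$, $n\geq 1$, is a Hopf subalgebra of $H_{CK}$. Put $G(x,L)=\sum_{n\ge 0}\phi(t_n)x^n\in\mathbb K[L][[x]]$. Then $\Delta(t_n)=\sum_{i=0}^{n}\tau_{n,n-i}\otimes t_i$ for suitable $\tau_{n,n-i}\in H_{CK}$ (which are unique), and we put $c_{n,i}=\frac{\partial}{\partial L}\phi(\tau_{n,n-i})\big|_{L=0}$ for $0\le i\le n$. For $m\ge 0$ consider: (A) $G$ satisfies a (possibly non-homogeneous) generalized renormalization group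 equation of order $m$: there are $\gamma_0\in\mathbb K[[x]]$ and $\bar\beta(x,\partial_x)=\sum_{j=0}^m\beta^{(j)}(x)\partial_x^j$ with $\beta^{(j)}\in\mathbb K[[x]]$ and $\beta^{(m)}\ne 0$ such that $\partial_L G=\bar\beta(x,\partial_x)G+\gamma_0(x)$. (B) Along the diagonals $n-i=k$, $c_{n,i}$ is polynomial in $i$, of degree $m$: there are polynomials $p_k\in\mathbb K[X]$ $(k\ge 1)$ of degree at most $m$, at least one of them of degree exactly $m$, with $c_{k+i,i}=p_k(i)$ for all $k\ge1$ and $i\ge 1$. Then (B) implies (A). If moreover the coefficient of $L$ in $\phi(\bullet)$ is nonzero and $\sum_{|T|=n}a_T/T!\ne 0$ for all $n\ge1$, where $T!=\prod_{v\in T}|T_v|$ is the tree factorial ($T_v$ being the subtree of $T$ rooted at $v$), then (A) and (B) are equivalent. -/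

import Mathlib

open scoped TensorProduct Polynomial

noncomputable section

namespace ConnesKreimer

/-! ### Rooted trees without plane structure -/

/-- Finite non-empty rooted trees with an ordering of the children of every vertex. -/
inductive PlaneTree : Type
  | node : List PlaneTree → PlaneTree

namespace PlaneTree

/-- Two plane trees are isomorphic as rooted trees: up to order, the subtrees at the children of
the two roots are pairwise isomorphic. -/
inductive Iso : PlaneTree → PlaneTree → Prop
  | node {l m : List PlaneTree} :
      Multiset.Rel Iso (l : Multiset PlaneTree) (m : Multiset PlaneTree) →
      Iso (PlaneTree.node l) (PlaneTree.node m)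

theorem iso_node {l m : List PlaneTree} :
    Iso (node l) (node m) ↔ Multiset.Rel Iso (l : Multiset PlaneTree) (m : Multiset PlaneTree) :=
  ⟨fun h => by cases h; assumption, Iso.node⟩

theorem induct {P : PlaneTree → Prop} (h : ∀ l, (∀ t ∈ l, P t) → P (node l)) : ∀ t, P t
  | node l => h l (fun t _ => induct h t)

theorem Iso.refl (t : PlaneTree) : Iso t t := by
  induction t using induct with
  | h l ih => exact Iso.node (Multiset.rel_refl_of_refl_on (by simpa using ih))

theorem Iso.symm {s t : PlaneTree} (h : Iso s t) : Iso t s := by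
  induction s using induct generalizing t with
  | h l ih =>
    obtain ⟨m⟩ := t
    rw [iso_node] at h ⊢
    exact Multiset.rel_flip.mp (h.mono fun a ha b _ hab => ih a (by simpa using ha) hab)

theorem rel_trans_of_mem {α : Type*} {r : α → α → Prop} (s : Multiset α) :
    ∀ {t u : Multiset α}, (∀ a ∈ s, ∀ b c, r a b → r b c → r a c) →
      Multiset.Rel r s t → Multiset.Rel r t u → Multiset.Rel r s u := by
  induction s using Multiset.induction_on with
  | empty =>
    intro t u _ h1 h2
    rw [Multiset.rel_zero_left] at h1
    subst h1
    exact h2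
  | cons a s ih =>
    intro t u h h1 h2
    obtain ⟨b, t', hab, hst, rfl⟩ := Multiset.rel_cons_left.mp h1
    obtain ⟨c, u', hbc, htu, rfl⟩ := Multiset.rel_cons_left.mp h2
    exact Multiset.Rel.cons (h a (Multiset.mem_cons_self a s) b c hab hbc)
      (ih (fun x hx => h x (Multiset.mem_cons_of_mem hx)) hst htu)

theorem Iso.trans {s t u : PlaneTree} (h1 : Iso s t) (h2 : Iso t u) : Iso s u := by
  induction s using induct generalizing t u with
  | h l ih =>
    obtain ⟨m⟩ := t
    obtain ⟨n⟩ := u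
    rw [iso_node] at h1 h2 ⊢
    exact rel_trans_of_mem _ (fun a ha b c => ih a (by simpa using ha)) h1 h2

instance isoSetoid : Setoid PlaneTree := ⟨Iso, ⟨Iso.refl, Iso.symm, Iso.trans⟩⟩

theorem map_eq_of_rel {β : Type*} {f : PlaneTree → β} {l m : List PlaneTree}
    (h : Multiset.Rel Iso (l : Multiset PlaneTree) (m : Multiset PlaneTree))
    (hf : ∀ a ∈ l, ∀ b, Iso a b → f a = f b) :
    (l : Multiset PlaneTree).map f = (m : Multiset PlaneTree).map f := by
  rw [← Multiset.rel_eq, Multiset.rel_map]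
  exact h.mono fun a ha b _ hab => hf a (by simpa using ha) b hab

end PlaneTree

/-- Rooted trees: finite, non-empty, without plane structure, up to isomorphism. -/
def Tree : Type := Quotient PlaneTree.isoSetoid

/-- Rooted forests, as multisets of rooted trees. -/
abbrev Forest : Type := Multiset Tree

/-- The isomorphism class of a plane tree. -/
def PlaneTree.toTree (t : PlaneTree) : Tree := Quotient.mk PlaneTree.isoSetoid t

/-- `graft F` is the tree obtained by joining the roots of the trees of `F` to a new root. -/
def graft (F : Forest) : Tree := (PlaneTree.node (F.map Quotient.out).toList).toTree

theorem graft_map_toTree (l : List PlaneTree) :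
    graft ((l : Multiset PlaneTree).map PlaneTree.toTree) = (PlaneTree.node l).toTree := by
  apply Quotient.sound
  refine PlaneTree.Iso.node ?_
  rw [Multiset.coe_toList]
  refine Multiset.rel_map_left.mpr (Multiset.rel_map_left.mpr ?_)
  exact Multiset.rel_refl_of_refl_on fun t _ => Quotient.mk_out (s := PlaneTree.isoSetoid) t

theorem Tree.induct {P : Tree → Prop} (h : ∀ F : Forest, (∀ t ∈ F, P t) → P (graft F)) :
    ∀ t, P t := by
  intro t
  induction t using Quotient.inductionOn with
  | h t =>
    induction t using PlaneTree.induct with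
    | h l ih =>
      have := h ((l : Multiset PlaneTree).map PlaneTree.toTree) (by
        intro t ht
        obtain ⟨a, ha, rfl⟩ := Multiset.mem_map.mp ht
        exact ih a (by simpa using ha))
      rwa [graft_map_toTree] at this

/-- The one-vertex tree. -/
def bullet : Tree := graft 0

namespace PlaneTree

/-- The number of vertices. -/
def size : PlaneTree → ℕ
  | node l => 1 + (l.map fun t => size t).sum

/-- The tree factorial: the product over all vertices `v` of the number of vertices of the
subtree rooted at `v`. -/
def factorial : PlaneTree → ℕ
  | node l => (node l).size * (l.map fun t => factorial t).prod

/-- The pairs `(P, R)` of pruned forest and remaining trunk, over all admissible cuts of a tree,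
the empty cut included. Such a cut amounts to an independent choice, for each child `t` of the
root, between cutting the edge above `t` (and then no edge of `t`) and an admissible, possibly
empty, cut of `t`. In the first case `t` joins the pruned forest; in the second the trunk of the
cut of `t` stays attached to the root. (`Multiset.Sections` runs over all choices of one element
from each member of a family of multisets, with multiplicity.) -/
def cuts : PlaneTree → Multiset (Forest × Tree)
  | node l =>
    (Multiset.Sections (Multiset.ofList (l.map fun t =>
        ({t.toTree}, 0) ::ₘ (cuts t).map fun c => ((c.1, {c.2}) : Forest × Forest)))).map
      fun s => ((s.map Prod.fst).sum, graft (s.map Prod.snd).sum)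

theorem size_node (l : List PlaneTree) :
    (node l).size = 1 + ((l : Multiset PlaneTree).map size).sum := by
  rw [size, Multiset.map_coe, Multiset.sum_coe]

theorem factorial_node (l : List PlaneTree) :
    (node l).factorial = (node l).size * ((l : Multiset PlaneTree).map factorial).prod := by
  rw [factorial, Multiset.map_coe, Multiset.prod_coe]

theorem cuts_node (l : List PlaneTree) :
    (node l).cuts =
      (Multiset.Sections ((l : Multiset PlaneTree).map fun t =>
        ({t.toTree}, 0) ::ₘ (cuts t).map fun c => ((c.1, {c.2}) : Forest × Forest))).map
      fun s => ((s.map Prod.fst).sum, graft (s.map Prod.snd).sum) := by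
  rw [cuts, Multiset.map_coe]

theorem size_eq_of_iso {s t : PlaneTree} (h : Iso s t) : s.size = t.size := by
  induction s using induct generalizing t with
  | h l ih =>
    obtain ⟨m⟩ := t
    rw [size_node, size_node, map_eq_of_rel (iso_node.mp h) fun a ha b hab => ih a ha hab]

theorem factorial_eq_of_iso {s t : PlaneTree} (h : Iso s t) : s.factorial = t.factorial := by
  induction s using induct generalizing t with
  | h l ih =>
    obtain ⟨m⟩ := t
    rw [factorial_node, factorial_node, size_eq_of_iso h,
      map_eq_of_rel (iso_node.mp h) fun a ha b hab => ih a ha hab]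

theorem cuts_eq_of_iso {s t : PlaneTree} (h : Iso s t) : s.cuts = t.cuts := by
  induction s using induct generalizing t with
  | h l ih =>
    obtain ⟨m⟩ := t
    rw [cuts_node, cuts_node, map_eq_of_rel (iso_node.mp h)]
    intro a ha b hab
    rw [ih a ha hab, show a.toTree = b.toTree from Quotient.sound hab]

end PlaneTree

namespace Tree

/-- The number of vertices of a rooted tree. -/
def size : Tree → ℕ := Quotient.lift PlaneTree.size fun _ _ h => PlaneTree.size_eq_of_iso h

/-- The tree factorial `T!`. -/
def factorial : Tree → ℕ :=
  Quotient.lift PlaneTree.factorial fun _ _ h => PlaneTree.factorial_eq_of_iso h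

/-- The pairs `(P^c(T), R^c(T))` over all admissible cuts `c` of `T`, the empty cut included. -/
def cuts : Tree → Multiset (Forest × Tree) :=
  Quotient.lift PlaneTree.cuts fun _ _ h => PlaneTree.cuts_eq_of_iso h

theorem exists_list (F : Forest) :
    ∃ l : List PlaneTree, (l : Multiset PlaneTree).map PlaneTree.toTree = F := by
  refine ⟨(F.map Quotient.out).toList, ?_⟩
  rw [Multiset.coe_toList]
  refine (Multiset.map_map _ _ _).trans ((Multiset.map_congr rfl fun T _ => ?_).trans
    (Multiset.map_id F))
  exact Quotient.out_eq (s := PlaneTree.isoSetoid) T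

theorem size_graft (F : Forest) : (graft F).size = 1 + (F.map size).sum := by
  obtain ⟨l, rfl⟩ := exists_list F
  rw [graft_map_toTree, Multiset.map_map]
  exact PlaneTree.size_node l

theorem factorial_graft (F : Forest) :
    (graft F).factorial = (graft F).size * (F.map factorial).prod := by
  obtain ⟨l, rfl⟩ := exists_list F
  rw [graft_map_toTree, Multiset.map_map]
  exact PlaneTree.factorial_node l

theorem cuts_graft (F : Forest) :
    (graft F).cuts =
      (Multiset.Sections (F.map fun T =>
        ({T}, 0) ::ₘ T.cuts.map fun c => ((c.1, {c.2}) : Forest × Forest))).map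
      fun s => ((s.map Prod.fst).sum, graft (s.map Prod.snd).sum) := by
  obtain ⟨l, rfl⟩ := exists_list F
  rw [graft_map_toTree, Multiset.map_map]
  exact PlaneTree.cuts_node l

end Tree

/-! ### The Connes-Kreimer Hopf algebra -/

/-- The polynomial algebra on rooted trees; a monomial is a forest. -/
abbrev HCK (K : Type*) [Field K] : Type _ := MvPolynomial Tree K

section HopfAlgebra

variable (K : Type*) [Field K]

/-- A tree, as an element of the Connes-Kreimer Hopf algebra. -/
def ofTree (T : Tree) : HCK K := MvPolynomial.X T

/-- A forest, as an element of the Connes-Kreimer Hopf algebra: the product of its trees. -/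
def ofForest (F : Forest) : HCK K := (F.map (ofTree K)).prod

/-- The coproduct: the algebra homomorphism with
`Δ(T) = T ⊗ 1 + ∑ P^c(T) ⊗ R^c(T)`, where `c` runs over all admissible cuts of `T`,
the empty cut contributing `1 ⊗ T`. -/
def comul : HCK K →ₐ[K] HCK K ⊗[K] HCK K :=
  MvPolynomial.aeval fun T =>
    ofTree K T ⊗ₜ[K] 1 + (T.cuts.map fun c => ofForest K c.1 ⊗ₜ[K] ofTree K c.2).sum

/-- The counit: it vanishes on all trees. -/
def counit : HCK K →ₐ[K] K := MvPolynomial.aeval fun _ => 0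

/-- An antipode: a two-sided convolution inverse of the identity. -/
def IsAntipode (S : HCK K →ₗ[K] HCK K) : Prop :=
  ∀ h : HCK K,
    LinearMap.mul' K (HCK K) (TensorProduct.map S LinearMap.id (comul K h)) =
        algebraMap K (HCK K) (counit K h) ∧
      LinearMap.mul' K (HCK K) (TensorProduct.map LinearMap.id S (comul K h)) =
        algebraMap K (HCK K) (counit K h)

variable {K}

/-- A Hopf subalgebra: a subalgebra `A` with `Δ(A) ⊆ A ⊗ A` that is stable under the antipode. -/
def IsHopfSubalgebra (A : Subalgebra K (HCK K)) : Prop :=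
  (∀ a ∈ A, comul K a ∈ (Algebra.TensorProduct.map A.val A.val).range) ∧
    ∀ S : HCK K →ₗ[K] HCK K, IsAntipode K S → ∀ a ∈ A, S a ∈ A

/-- The coproduct of `K[L]`, with `Δ(L) = L ⊗ 1 + 1 ⊗ L`. -/
def polyComul (K : Type*) [Field K] : K[X] →ₐ[K] K[X] ⊗[K] K[X] :=
  Polynomial.aeval (Polynomial.X ⊗ₜ[K] 1 + 1 ⊗ₜ[K] Polynomial.X)

/-- Feynman rules: Hopf algebra morphisms from the Connes-Kreimer Hopf algebra to `K[L]`
(the counit of `K[L]` is evaluation at `0`). -/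
structure IsFeynmanRules (φ : HCK K →ₐ[K] K[X]) : Prop where
  map_comul : ∀ h, polyComul K (φ h) = Algebra.TensorProduct.map φ φ (comul K h)
  map_counit : ∀ h, (φ h).eval 0 = counit K h

/-- `t₀ = 1`, and `t₁, t₂, …` are nonzero linear combinations of trees, `tₙ` of degree `n`, that
generate a Hopf subalgebra. -/
structure GeneratesHopfSubalgebra (t : ℕ → HCK K) : Prop where
  zero : t 0 = 1
  ne_zero : ∀ n, 1 ≤ n → t n ≠ 0
  mem_span : ∀ n, 1 ≤ n → t n ∈ Submodule.span K (ofTree K '' {T | T.size = n})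
  hopf : IsHopfSubalgebra (Algebra.adjoin K (t '' {n | 1 ≤ n}))

/-- `τ n k` are the left tensor factors in `Δ(tₙ) = ∑ᵢ τ_{n,n-i} ⊗ tᵢ`, `0 ≤ i ≤ n`. -/
def IsCoproductArray (t : ℕ → HCK K) (τ : ℕ → ℕ → HCK K) : Prop :=
  ∀ n, comul K (t n) = ∑ i ∈ Finset.range (n + 1), τ n (n - i) ⊗ₜ[K] t i

/-- `c_{n,i}`, the derivative of `φ(τ_{n,n-i})` at `L = 0`. -/
def coeffC (φ : HCK K →ₐ[K] K[X]) (τ : ℕ → ℕ → HCK K) (n i : ℕ) : K :=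
  (Polynomial.derivative (φ (τ n (n - i)))).eval 0

/-- The linear form (extended multiplicatively) with `T ↦ 1 / T!` on trees. -/
def invFactorial (K : Type*) [Field K] : HCK K →ₐ[K] K :=
  MvPolynomial.aeval fun T => ((T.factorial : K))⁻¹

end HopfAlgebra

/-! ### Green functions and generalized renormalization group equations -/

section GreenFunction

variable {K : Type*} [Field K]

/-- The Green function `G(x, L) = φ(X) = ∑ φ(tₙ) xⁿ`, a power series in `x` over `K[L]`. -/
def greenFunction (φ : HCK K →ₐ[K] K[X]) (t : ℕ → HCK K) : PowerSeries K[X] :=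
  PowerSeries.mk fun n => φ (t n)

/-- The formal partial derivative `∂/∂L`. -/
def dL (G : PowerSeries K[X]) : PowerSeries K[X] :=
  PowerSeries.mk fun n => Polynomial.derivative (PowerSeries.coeff n G)

/-- The formal partial derivative `∂/∂x`. -/
def dx (G : PowerSeries K[X]) : PowerSeries K[X] := PowerSeries.derivative K[X] G

/-- A power series in `x` with coefficients in `K`, as a power series in `x` over `K[L]`. -/
def constL (f : PowerSeries K) : PowerSeries K[X] := PowerSeries.map Polynomial.C f

/-- The action of the differential operator `β(x, ∂/∂x) = ∑ⱼ β⁽ʲ⁾(x) ∂ʲ/∂xʲ`, a polynomial in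
`∂/∂x` over `K[[x]]`. -/
def applyOp (β : Polynomial (PowerSeries K)) (G : PowerSeries K[X]) : PowerSeries K[X] :=
  β.sum fun j b => constL b * dx^[j] G

/-- `G` satisfies a (possibly non-homogeneous) generalized renormalization group equation
`∂G/∂L = β(x, ∂/∂x) G + γ₀(x)` of order `m`. -/
def SatisfiesRGE (m : ℕ) (G : PowerSeries K[X]) : Prop :=
  ∃ (β : Polynomial (PowerSeries K)) (γ₀ : PowerSeries K),
    β.degree = m ∧ dL G = applyOp β G + constL γ₀

/-- The array `c` is polynomial of degree `m` in `i` along its diagonals `n - i = k`, `k ≥ 1`: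
for `i ≥ 1` each diagonal is given by a polynomial in `i`, and `m` is the largest degree of
these polynomials. -/
def DiagonalsPolynomial (m : ℕ) (c : ℕ → ℕ → K) : Prop :=
  ∃ p : ℕ → K[X],
    (∀ k, 1 ≤ k → (p k).degree ≤ m ∧ ∀ i : ℕ, 1 ≤ i → c (k + i) i = (p k).eval (i : K)) ∧
      ∃ k, 1 ≤ k ∧ (p k).degree = m

end GreenFunction

end ConnesKreimer

end

namespace ConnesKreimer

/-! ### Cuts and sizes -/

/-! The coproduct of `K[L]` is `p(L) ↦ p(L + L')`, so differentiating one tensor factor at the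
origin recovers `p'`. Compatibility of `φ` with coproducts therefore turns `Δ(tₙ) = ∑ τ_{n,n-i} ⊗
tᵢ` into the triangular system `∂_L φ(tₙ) = ∑ c_{n,i} φ(tᵢ)`, which is strictly triangular because
`c_{n,n} = 0` (`coeffC_self`).

A differential operator acts on the coefficients of `G` by a matrix as well: its `(n, i)` entry is
`∑ⱼ β⁽ʲ⁾_{n+j-i} i(i-1)⋯(i-j+1)`. On each diagonal `n - i = k` this is a polynomial in `i`, written
in the basis of falling factorials. Hence polynomial diagonals prescribe the operator, with column
`i = 0` absorbed by `γ₀` because `φ(t₀) = 1`; this gives (B) ⇒ (A).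

For the converse the two matrices must be compared entrywise, which requires linear independence of
the `φ(tₙ)`. It holds because `φ(T)` has degree at most `|T|` and its coefficient of `L^|T|` is
`a^|T| / T!`, where `a` is the coefficient of `L` in `φ(•)` (`natDegree_le_and_coeff_ofTree`); so
under the two nonvanishing hypotheses `φ(tₙ)` has degree exactly `n`. The diagonals with `k ≤ 0`
carry no coefficients `c`, which forces the top coefficient `β⁽ᵐ⁾` to show up on some diagonal `k ≥
1`. -/

/-- The number of vertices of a forest. -/
def Forest.size (F : Forest) : ℕ := (F.map Tree.size).sum

@[simp] theorem Forest.size_zero : Forest.size 0 = 0 := rfl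

theorem Forest.size_add (F F' : Forest) : (F + F').size = F.size + F'.size := by
  simp [Forest.size]

theorem Forest.size_cons (T : Tree) (F : Forest) : Forest.size (T ::ₘ F) = T.size + F.size := by
  simp [Forest.size]

theorem Forest.size_singleton (T : Tree) : Forest.size {T} = T.size := by
  simp [Forest.size]

namespace Tree

theorem size_graft_eq (F : Forest) : (graft F).size = 1 + F.size := size_graft F

theorem size_pos (T : Tree) : 1 ≤ T.size := by
  induction T using Tree.induct with
  | h F _ => rw [size_graft]; omega

theorem _root_.ConnesKreimer.Forest.eq_zero_of_size {F : Forest} (h : F.size = 0) : F = 0 := by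
  induction F using Multiset.induction_on with
  | empty => rfl
  | cons T F _ =>
    rw [Forest.size_cons] at h
    have := T.size_pos
    omega

/-- The choices made by an admissible cut of `graft F` at the child `T` of the root. -/
noncomputable def branches (T : Tree) : Multiset (Forest × Forest) :=
  ({T}, 0) ::ₘ T.cuts.map fun c => (c.1, {c.2})

theorem cuts_graft_eq (F : Forest) :
    (graft F).cuts = (Multiset.Sections (F.map branches)).map
      fun s => ((s.map Prod.fst).sum, graft (s.map Prod.snd).sum) :=
  cuts_graft F

/-- If a function is multiplicative on pairs of forests, then its sum over the pairs obtained by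
cutting the trees of a forest is the product of the sums for the trees. -/
theorem sum_sections_branches {R : Type*} [CommSemiring R] (f : Forest × Forest → R)
    (hf0 : f 0 = 1) (hf : ∀ c d, f (c + d) = f c * f d) (F : Forest) :
    ((Multiset.Sections (F.map branches)).map fun s =>
        f ((s.map Prod.fst).sum, (s.map Prod.snd).sum)).sum =
      (F.map fun T => (T.branches.map f).sum).prod := by
  induction F using Multiset.induction_on with
  | empty =>
    simp only [Multiset.map_zero, Multiset.sections_zero, Multiset.map_singleton,
      Multiset.sum_singleton, Multiset.prod_zero, Multiset.sum_zero]
    exact hf0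
  | cons T F ih =>
    rw [Multiset.map_cons, Multiset.sections_cons, Multiset.map_bind, Multiset.sum_bind,
      Multiset.map_cons, Multiset.prod_cons, ← ih, ← Multiset.sum_map_mul_right]
    congr 1
    refine Multiset.map_congr rfl fun c _ => ?_
    rw [← Multiset.sum_map_mul_left, Multiset.map_map]
    congr 1
    refine Multiset.map_congr rfl fun s _ => ?_
    rw [← hf]
    simp [Prod.add_def]

theorem size_sections {F : Forest} {s : Multiset (Forest × Forest)}
    (hF : ∀ T ∈ F, ∀ c ∈ T.branches, c.1.size + c.2.size = T.size)
    (hs : s ∈ Multiset.Sections (F.map branches)) :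
    Forest.size (s.map Prod.fst).sum + Forest.size (s.map Prod.snd).sum = F.size := by
  induction F using Multiset.induction_on generalizing s with
  | empty =>
    rw [Multiset.map_zero, Multiset.sections_zero, Multiset.mem_singleton] at hs
    subst hs
    rfl
  | cons T F ih =>
    rw [Multiset.map_cons, Multiset.sections_cons, Multiset.mem_bind] at hs
    obtain ⟨c, hc, hs⟩ := hs
    obtain ⟨r, hr, rfl⟩ := Multiset.mem_map.mp hs
    have h1 := hF T (Multiset.mem_cons_self T F) c hc
    have h2 := ih (fun T hT => hF T (Multiset.mem_cons_of_mem hT)) hr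
    simp only [Multiset.map_cons, Multiset.sum_cons, Forest.size_add, Forest.size_cons]
    omega

/-- A cut distributes the vertices over the pruned forest and the trunk. -/
theorem size_cuts (T : Tree) : ∀ c ∈ T.cuts, c.1.size + c.2.size = T.size := by
  induction T using Tree.induct with
  | h F ih =>
    intro c hc
    rw [cuts_graft_eq] at hc
    obtain ⟨s, hs, rfl⟩ := Multiset.mem_map.mp hc
    rw [size_graft_eq, size_graft_eq, ← size_sections _ hs]
    · dsimp only
      omega
    · intro T hT c hc
      rw [branches, Multiset.mem_cons] at hc
      rcases hc with rfl | hc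
      · simp [Forest.size_singleton]
      · obtain ⟨d, hd, rfl⟩ := Multiset.mem_map.mp hc
        simpa [Forest.size_singleton] using ih T hT d hd

end Tree

variable {K : Type*} [Field K]

theorem comul_ofTree (T : Tree) :
    comul K (ofTree K T) = ofTree K T ⊗ₜ[K] 1 +
      (T.cuts.map fun c => ofForest K c.1 ⊗ₜ[K] ofTree K c.2).sum := by
  simp [comul, ofTree]

theorem ofForest_cons (T : Tree) (F : Forest) :
    ofForest K (T ::ₘ F) = ofTree K T * ofForest K F := by
  simp [ofForest]

/-! ### Differentiation at the origin -/

/-- The derivative at the origin. -/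
noncomputable def derivZero (K : Type*) [Field K] : K[X] →ₗ[K] K :=
  Polynomial.leval 0 ∘ₗ Polynomial.derivative

theorem derivZero_apply (p : K[X]) : derivZero K p = p.derivative.eval 0 := rfl

theorem derivZero_eq_coeff (p : K[X]) : derivZero K p = p.coeff 1 := by
  rw [derivZero_apply, ← Polynomial.coeff_zero_eq_eval_zero, Polynomial.coeff_derivative]
  simp

/-- `p ⊗ q ↦ p(0) q`. -/
noncomputable def evalLeft (K : Type*) [Field K] : K[X] ⊗[K] K[X] →ₗ[K] K[X] :=
  TensorProduct.lift (LinearMap.lsmul K K[X] ∘ₗ Polynomial.leval 0)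

/-- `p ⊗ q ↦ p'(0) q`. -/
noncomputable def derivLeft (K : Type*) [Field K] : K[X] ⊗[K] K[X] →ₗ[K] K[X] :=
  TensorProduct.lift (LinearMap.lsmul K K[X] ∘ₗ derivZero K)

@[simp] theorem evalLeft_tmul (p q : K[X]) : evalLeft K (p ⊗ₜ q) = p.eval 0 • q := rfl

@[simp] theorem derivLeft_tmul (p q : K[X]) : derivLeft K (p ⊗ₜ q) = derivZero K p • q := rfl

theorem evalLeft_mul (u : K[X] ⊗[K] K[X]) :
    evalLeft K (u * (Polynomial.X ⊗ₜ[K] 1 + 1 ⊗ₜ[K] Polynomial.X)) =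
      evalLeft K u * Polynomial.X := by
  induction u with
  | zero => simp
  | tmul p q => simp [mul_add]
  | add u v hu hv => rw [add_mul, map_add, hu, hv, map_add, add_mul]

/-- Leibniz rule at the origin of the left variable: this is the inductive step for powers of
`Δ(L)`. -/
theorem derivLeft_mul (u : K[X] ⊗[K] K[X]) :
    derivLeft K (u * (Polynomial.X ⊗ₜ[K] 1 + 1 ⊗ₜ[K] Polynomial.X)) =
      evalLeft K u + derivLeft K u * Polynomial.X := by
  induction u with
  | zero => simp
  | tmul p q => simp [mul_add, derivZero_apply]
  | add u v hu hv => rw [add_mul, map_add, hu, hv, map_add, map_add, add_mul]; abel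

theorem polyComul_X_pow_succ (n : ℕ) :
    polyComul K (Polynomial.X ^ (n + 1)) =
      polyComul K (Polynomial.X ^ n) * (Polynomial.X ⊗ₜ[K] 1 + 1 ⊗ₜ[K] Polynomial.X) := by
  rw [pow_succ, map_mul]
  simp [polyComul]

theorem evalLeft_polyComul_X_pow (n : ℕ) :
    evalLeft K (polyComul K (Polynomial.X ^ n)) = Polynomial.X ^ n := by
  induction n with
  | zero => simp [Algebra.TensorProduct.one_def]
  | succ n ih => rw [polyComul_X_pow_succ, evalLeft_mul, ih, pow_succ]

/-- The derivative is the infinitesimal generator of translations: differentiate `p(L + L')` in the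
left variable at `0`. -/
theorem derivLeft_polyComul (p : K[X]) :
    derivLeft K (polyComul K p) = Polynomial.derivative p := by
  suffices h : derivLeft K ∘ₗ (polyComul K).toLinearMap = Polynomial.derivative from
    LinearMap.congr_fun h p
  refine Polynomial.lhom_ext' fun n => LinearMap.ext_ring ?_
  simp only [LinearMap.comp_apply, AlgHom.toLinearMap_apply, ← Polynomial.X_pow_eq_monomial]
  induction n with
  | zero => simp [Algebra.TensorProduct.one_def, derivZero_apply]
  | succ n ih =>
    rw [polyComul_X_pow_succ, derivLeft_mul, ih, evalLeft_polyComul_X_pow, pow_succ,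
      Polynomial.derivative_mul]
    simp [add_comm]

theorem comm_polyComul (p : K[X]) :
    TensorProduct.comm K K[X] K[X] (polyComul K p) = polyComul K p := by
  have h : (Algebra.TensorProduct.comm K K[X] K[X] : K[X] ⊗[K] K[X] →ₐ[K] K[X] ⊗[K] K[X]).comp
      (polyComul K) = polyComul K := by
    apply Polynomial.algHom_ext
    simp [polyComul, add_comm]
  exact DFunLike.congr_fun h p

section FeynmanRules

variable {φ : HCK K →ₐ[K] K[X]}

theorem IsFeynmanRules.derivative_eq (hφ : IsFeynmanRules φ) (h : HCK K) :
    (φ h).derivative = derivLeft K (Algebra.TensorProduct.map φ φ (comul K h)) := by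
  rw [← hφ.map_comul, derivLeft_polyComul]

/-- Cocommutativity of `K[L]` allows differentiating the right factor instead. On trees this leaves
the pruned forest intact, so that induction on size applies to its smaller trees. -/
theorem IsFeynmanRules.derivative_eq' (hφ : IsFeynmanRules φ) (h : HCK K) :
    (φ h).derivative = derivLeft K (TensorProduct.comm K K[X] K[X]
      (Algebra.TensorProduct.map φ φ (comul K h))) := by
  rw [← hφ.map_comul, comm_polyComul, derivLeft_polyComul]

/-- The derivatives of the coefficients of the Green function. -/
theorem IsFeynmanRules.derivative_of_isCoproductArray (hφ : IsFeynmanRules φ) {t : ℕ → HCK K}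
    {τ : ℕ → ℕ → HCK K} (hτ : IsCoproductArray t τ) (n : ℕ) :
    (φ (t n)).derivative = ∑ i ∈ Finset.range (n + 1), coeffC φ τ n i • φ (t i) := by
  rw [hφ.derivative_eq, hτ n, map_sum, map_sum]
  rfl

theorem IsFeynmanRules.derivative_ofTree (hφ : IsFeynmanRules φ) (T : Tree) :
    (φ (ofTree K T)).derivative =
      (T.cuts.map fun c => derivZero K (φ (ofTree K c.2)) • φ (ofForest K c.1)).sum := by
  rw [hφ.derivative_eq', comul_ofTree, map_add, map_add, map_add, map_multiset_sum,
    map_multiset_sum, map_multiset_sum, Multiset.map_map, Multiset.map_map, Multiset.map_map]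
  simp [derivZero_apply, Function.comp_def]

end FeynmanRules

/-! ### The coproduct of a generator -/

/-- The projection onto the span of `1` and of the trees with at most `n` vertices. -/
noncomputable def treeProjection (K : Type*) [Field K] (n : ℕ) : HCK K →ₗ[K] HCK K :=
  MvPolynomial.homogeneousComponent 0 +
    ∑ i ∈ Finset.Icc 1 n,
      MvPolynomial.weightedHomogeneousComponent Tree.size i ∘ₗ MvPolynomial.homogeneousComponent 1

theorem treeProjection_one (n : ℕ) : treeProjection K n 1 = 1 := by
  have h := fun m => MvPolynomial.homogeneousComponent_of_mem (m := m)
    (MvPolynomial.isHomogeneous_one Tree K)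
  simp [treeProjection, h]

theorem treeProjection_of_two_le {n d : ℕ} (hd : 2 ≤ d) {x : HCK K} (hx : x.IsHomogeneous d) :
    treeProjection K n x = 0 := by
  have h := fun m => MvPolynomial.homogeneousComponent_of_mem (m := m) hx
  simp [treeProjection, h, show 0 ≠ d by omega, show 1 ≠ d by omega]

theorem treeProjection_of_linear {n i : ℕ} (hi : 1 ≤ i) {x : HCK K} (hx : x.IsHomogeneous 1)
    (hw : MvPolynomial.IsWeightedHomogeneous Tree.size x i) :
    treeProjection K n x = if i ≤ n then x else 0 := by
  have h := fun m => MvPolynomial.homogeneousComponent_of_mem (m := m) hx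
  have h' := fun m => MvPolynomial.weightedHomogeneousComponent_of_mem (m := m) hw
  simp [treeProjection, h, h', hi]

theorem isHomogeneous_ofTree (T : Tree) : (ofTree K T).IsHomogeneous 1 :=
  MvPolynomial.isHomogeneous_X K T

theorem isWeightedHomogeneous_ofTree (T : Tree) :
    MvPolynomial.IsWeightedHomogeneous Tree.size (ofTree K T) T.size :=
  MvPolynomial.isWeightedHomogeneous_X K Tree.size T

theorem treeProjection_ofTree {n : ℕ} {T : Tree} (hT : T.size ≤ n) :
    treeProjection K n (ofTree K T) = ofTree K T := by
  rw [treeProjection_of_linear T.size_pos (isHomogeneous_ofTree T)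
    (isWeightedHomogeneous_ofTree T), if_pos hT]

theorem ofForest_zero : ofForest K 0 = 1 := rfl

theorem Tree.size_trunk_le {T : Tree} {c : Forest × Tree} (hc : c ∈ T.cuts) :
    c.2.size ≤ T.size := by
  have := T.size_cuts c hc
  omega

/-- The right factors of `Δ(T)` are `1` and trunks, which are single trees no larger than `T`. -/
theorem lTensor_treeProjection_comul_ofTree (T : Tree) :
    (treeProjection K T.size).lTensor (HCK K) (comul K (ofTree K T)) = comul K (ofTree K T) := by
  rw [comul_ofTree, map_add, map_multiset_sum, Multiset.map_map, LinearMap.lTensor_tmul,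
    treeProjection_one]
  congr 2
  refine Multiset.map_congr rfl fun c hc => ?_
  rw [Function.comp_apply, LinearMap.lTensor_tmul,
    treeProjection_ofTree (Tree.size_trunk_le hc)]

namespace GeneratesHopfSubalgebra

variable {t : ℕ → HCK K}

theorem isHomogeneous (ht : GeneratesHopfSubalgebra t) {n : ℕ} (hn : 1 ≤ n) :
    (t n).IsHomogeneous 1 := by
  have : Submodule.span K (ofTree K '' {T | T.size = n}) ≤
      MvPolynomial.homogeneousSubmodule Tree K 1 := by
    rw [Submodule.span_le]
    rintro _ ⟨T, -, rfl⟩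
    exact isHomogeneous_ofTree T
  exact this (ht.mem_span n hn)

theorem isWeightedHomogeneous (ht : GeneratesHopfSubalgebra t) (n : ℕ) :
    MvPolynomial.IsWeightedHomogeneous Tree.size (t n) n := by
  rcases Nat.eq_zero_or_pos n with rfl | hn
  · rw [ht.zero]
    exact MvPolynomial.isWeightedHomogeneous_one K Tree.size
  have : Submodule.span K (ofTree K '' {T | T.size = n}) ≤
      MvPolynomial.weightedHomogeneousSubmodule K Tree.size n := by
    rw [Submodule.span_le]
    rintro _ ⟨T, rfl, rfl⟩
    exact isWeightedHomogeneous_ofTree T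
  exact this (ht.mem_span n hn)

/-- The algebra is spanned by products of generators; the projection kills those with at least two
factors and the generators of size above `n`. -/
theorem treeProjection_mem (ht : GeneratesHopfSubalgebra t) (n : ℕ) {x : HCK K}
    (hx : x ∈ Algebra.adjoin K (t '' {n | 1 ≤ n})) :
    treeProjection K n x ∈ Submodule.span K (t '' Finset.range (n + 1)) := by
  rw [← Subalgebra.mem_toSubmodule, Algebra.adjoin_eq_span] at hx
  suffices h : Submodule.span K (Submonoid.closure (t '' {n | 1 ≤ n}) : Set (HCK K)) ≤
      (Submodule.span K (t '' Finset.range (n + 1))).comap (treeProjection K n) from h hx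
  rw [Submodule.span_le]
  intro y hy
  have key : y = 1 ∨ (∃ i, 1 ≤ i ∧ y = t i) ∨ ∃ d, 2 ≤ d ∧ y.IsHomogeneous d := by
    induction hy using Submonoid.closure_induction with
    | mem y hy =>
      obtain ⟨i, hi, rfl⟩ := hy
      exact Or.inr (Or.inl ⟨i, hi, rfl⟩)
    | one => exact Or.inl rfl
    | mul x y _ _ hx hy =>
      have hom : ∀ {z : HCK K}, ((∃ i, 1 ≤ i ∧ z = t i) ∨ ∃ d, 2 ≤ d ∧ z.IsHomogeneous d) →
          ∃ d, 1 ≤ d ∧ z.IsHomogeneous d := by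
        rintro z (⟨i, hi, rfl⟩ | ⟨d, hd, hz⟩)
        · exact ⟨1, le_rfl, ht.isHomogeneous hi⟩
        · exact ⟨d, by omega, hz⟩
      rcases hx with rfl | hx
      · rwa [one_mul]
      rcases hy with rfl | hy
      · rw [mul_one]
        exact Or.inr hx
      obtain ⟨d, hd, hx⟩ := hom hx
      obtain ⟨e, he, hy⟩ := hom hy
      exact Or.inr (Or.inr ⟨d + e, by omega, hx.mul hy⟩)
  rw [SetLike.mem_coe, Submodule.mem_comap]
  rcases key with rfl | ⟨i, hi, rfl⟩ | ⟨d, hd, hy⟩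
  · rw [treeProjection_one, ← ht.zero]
    exact Submodule.subset_span ⟨0, by simp, rfl⟩
  · rw [treeProjection_of_linear hi (ht.isHomogeneous hi) (ht.isWeightedHomogeneous i)]
    split_ifs with h
    · exact Submodule.subset_span ⟨i, by simpa using Nat.lt_succ_of_le h, rfl⟩
    · exact Submodule.zero_mem _
  · rw [treeProjection_of_two_le hd hy]
    exact Submodule.zero_mem _

theorem lTensor_treeProjection_comul (ht : GeneratesHopfSubalgebra t) {n : ℕ} (hn : 1 ≤ n) :
    (treeProjection K n).lTensor (HCK K) (comul K (t n)) = comul K (t n) := by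
  have : Submodule.span K (ofTree K '' {T | T.size = n}) ≤
      LinearMap.eqLocus ((treeProjection K n).lTensor (HCK K) ∘ₗ (comul K).toLinearMap)
        (comul K).toLinearMap := by
    rw [Submodule.span_le]
    rintro _ ⟨T, rfl, rfl⟩
    exact lTensor_treeProjection_comul_ofTree T
  exact this (ht.mem_span n hn)

/-- Projecting the right factor does not change `Δ(tₙ)`, but sends the right factors, known to lie
in the subalgebra, into the span of `t₀, …, tₙ`. -/
theorem exists_comul_eq_sum (ht : GeneratesHopfSubalgebra t) {n : ℕ} (hn : 1 ≤ n) :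
    ∃ u : ℕ → HCK K, comul K (t n) = ∑ i ∈ Finset.range (n + 1), u i ⊗ₜ[K] t i := by
  obtain ⟨z, hz⟩ := ht.hopf.1 _ (Algebra.subset_adjoin ⟨n, hn, rfl⟩)
  rw [← ht.lTensor_treeProjection_comul hn, ← hz]
  clear hz
  induction z with
  | zero => exact ⟨0, by simp⟩
  | tmul a b =>
    obtain ⟨r, hr⟩ := Submodule.mem_span_image_finset_iff_exists_fun' K |>.mp
      (ht.treeProjection_mem n b.2)
    refine ⟨fun i => r i • (a : HCK K), ?_⟩
    simp only [AlgHom.toRingHom_eq_coe, RingHom.coe_coe, Algebra.TensorProduct.map_tmul,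
      Subalgebra.coe_val, LinearMap.lTensor_tmul]
    rw [← hr, TensorProduct.tmul_sum]
    exact Finset.sum_congr rfl fun i _ => by rw [TensorProduct.smul_tmul]
  | add x y hx hy =>
    obtain ⟨u, hu⟩ := hx
    obtain ⟨v, hv⟩ := hy
    refine ⟨u + v, ?_⟩
    rw [map_add, map_add, hu, hv, ← Finset.sum_add_distrib]
    exact Finset.sum_congr rfl fun i _ => (TensorProduct.add_tmul _ _ _).symm

theorem exists_isCoproductArray (ht : GeneratesHopfSubalgebra t) :
    ∃ τ : ℕ → ℕ → HCK K, IsCoproductArray t τ := by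
  have h : ∀ n, ∃ u : ℕ → HCK K,
      comul K (t n) = ∑ i ∈ Finset.range (n + 1), u i ⊗ₜ[K] t i := by
    intro n
    rcases Nat.eq_zero_or_pos n with rfl | hn
    · exact ⟨fun _ => 1, by simp [ht.zero, Algebra.TensorProduct.one_def]⟩
    · exact ht.exists_comul_eq_sum hn
  choose u hu using h
  refine ⟨fun n k => u n (n - k), fun n => (hu n).trans (Finset.sum_congr rfl fun i hi => ?_)⟩
  beta_reduce
  rw [Nat.sub_sub_self (Nat.le_of_lt_succ (Finset.mem_range.mp hi))]

/-! ### The diagonal of the array of coefficients -/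

theorem coeffC_self (ht : GeneratesHopfSubalgebra t) {φ : HCK K →ₐ[K] K[X]}
    (hφ : IsFeynmanRules φ) {τ : ℕ → ℕ → HCK K} (hτ : IsCoproductArray t τ) (n : ℕ) :
    coeffC φ τ n n = 0 := by
  rcases Nat.eq_zero_or_pos n with rfl | hn
  · simpa [ht.zero] using (hφ.derivative_of_isCoproductArray hτ 0).symm
  obtain ⟨s, hs⟩ := MvPolynomial.ne_zero_iff.mp (ht.ne_zero n hn)
  have hsn := ht.isWeightedHomogeneous n hs
  have hzero : ∀ {x : HCK K} {i : ℕ}, MvPolynomial.IsWeightedHomogeneous Tree.size x i →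
      i ≠ n → x.coeff s = 0 := fun hx hi => hx.coeff_eq_zero s (by rw [hsn]; exact hi.symm)
  -- The form `x ⊗ y ↦ φ(x)'(0) · [s] y` isolates `c_{n,n}`, since the monomial `s` of weight `n`
  -- does not occur in `tᵢ` for `i < n`.
  let M : HCK K ⊗[K] HCK K →ₗ[K] K := TensorProduct.lift
    ((LinearMap.lsmul K K ∘ₗ derivZero K ∘ₗ φ.toLinearMap).compl₂ (MvPolynomial.lcoeff K s))
  have hM : ∀ x y : HCK K, M (x ⊗ₜ y) = derivZero K (φ x) * y.coeff s := fun x y => rfl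
  have h1 : M (comul K (t n)) = coeffC φ τ n n * (t n).coeff s := by
    rw [hτ n, map_sum, Finset.sum_range_succ, Finset.sum_eq_zero, zero_add, hM]
    · rfl
    · intro i hi
      rw [hM, hzero (ht.isWeightedHomogeneous i) (Finset.mem_range.mp hi).ne, mul_zero]
  have h2 : M (comul K (t n)) = 0 := by
    have : Submodule.span K (ofTree K '' {T | T.size = n}) ≤
        LinearMap.ker (M ∘ₗ (comul K).toLinearMap) := by
      rw [Submodule.span_le]
      rintro _ ⟨T, hT, rfl⟩
      change M (comul K (ofTree K T)) = 0
      rw [comul_ofTree, map_add, hM, hzero (MvPolynomial.isWeightedHomogeneous_one K _) (by omega),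
        mul_zero, zero_add, map_multiset_sum, Multiset.map_map]
      refine Multiset.sum_eq_zero fun x hx => ?_
      obtain ⟨c, hc, rfl⟩ := Multiset.mem_map.mp hx
      rw [Function.comp_apply, hM]
      by_cases h : c.2.size = n
      -- A trunk of full size comes from the empty cut, whose pruned forest is `1`; the derivative
      -- of `φ(1)` vanishes.
      · have := T.size_cuts c hc
        rw [show c.1 = 0 from Forest.eq_zero_of_size (by simp at hT; omega), ofForest_zero]
        simp [derivZero_apply]
      · rw [hzero (isWeightedHomogeneous_ofTree c.2) h, mul_zero]
    exact this (ht.mem_span n hn)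
  exact (mul_eq_zero.mp (h1.symm.trans h2)).resolve_right hs

end GeneratesHopfSubalgebra

/-! ### The leading coefficients of the Feynman rules -/

theorem natDegree_le_and_coeff_ofForest {φ : HCK K →ₐ[K] K[X]} {a : K} (F : Forest)
    (hF : ∀ T ∈ F, (φ (ofTree K T)).natDegree ≤ T.size ∧
      (φ (ofTree K T)).coeff T.size = a ^ T.size * (T.factorial : K)⁻¹) :
    (φ (ofForest K F)).natDegree ≤ F.size ∧
      (φ (ofForest K F)).coeff F.size =
        a ^ F.size * (((F.map Tree.factorial).prod : ℕ) : K)⁻¹ := by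
  induction F using Multiset.induction_on with
  | empty => simp [ofForest]
  | cons T F ih =>
    obtain ⟨h1, h2⟩ := hF T (Multiset.mem_cons_self T F)
    obtain ⟨h3, h4⟩ := ih fun T hT => hF T (Multiset.mem_cons_of_mem hT)
    rw [ofForest_cons, map_mul, Forest.size_cons]
    refine ⟨Polynomial.natDegree_mul_le_of_le h1 h3, ?_⟩
    rw [Polynomial.coeff_mul_add_eq_of_natDegree_le h1 h3, h2, h4, Multiset.map_cons,
      Multiset.prod_cons, Nat.cast_mul, mul_inv, pow_add]
    ring

/-- Strong induction through `∂_L φ(T) = ∑ φ(R)'(0) φ(P)`. Pruned forests have fewer than `|T|`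
vertices, and `|T| - 1` is reached only by cutting all edges at the root. Integrating that top term
divides by `|T|`, which is the recursion of the tree factorial. -/
theorem natDegree_le_and_coeff_ofTree [CharZero K] {φ : HCK K →ₐ[K] K[X]} (hφ : IsFeynmanRules φ)
    (T : Tree) :
    (φ (ofTree K T)).natDegree ≤ T.size ∧
      (φ (ofTree K T)).coeff T.size =
        (φ (ofTree K bullet)).coeff 1 ^ T.size * (T.factorial : K)⁻¹ := by
  set a := (φ (ofTree K bullet)).coeff 1 with ha
  induction hn : T.size using Nat.strong_induction_on generalizing T with
  | _ n ih =>
  subst hn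
  have ihF : ∀ F : Forest, F.size < T.size → (φ (ofForest K F)).natDegree ≤ F.size ∧
      (φ (ofForest K F)).coeff F.size =
        a ^ F.size * (((F.map Tree.factorial).prod : ℕ) : K)⁻¹ := by
    intro F hF
    refine natDegree_le_and_coeff_ofForest F fun S hS => ih S.size ?_ S rfl
    refine lt_of_le_of_lt ?_ hF
    exact Multiset.single_le_sum (fun _ _ => Nat.zero_le _) _ (Multiset.mem_map_of_mem _ hS)
  have hlt : ∀ c ∈ T.cuts, c.1.size < T.size := by
    intro c hc
    have := T.size_cuts c hc
    have := c.2.size_pos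
    omega
  have hder := hφ.derivative_ofTree T
  have hcoeff : ∀ k, (φ (ofTree K T)).coeff (k + 1) * (k + 1) =
      (T.cuts.map fun c => derivZero K (φ (ofTree K c.2)) * (φ (ofForest K c.1)).coeff k).sum := by
    intro k
    rw [← Polynomial.coeff_derivative, hder, ← Polynomial.lcoeff_apply, map_multiset_sum,
      Multiset.map_map]
    simp [Function.comp_def]
  constructor
  · rw [Polynomial.natDegree_le_iff_coeff_eq_zero]
    intro k hk
    obtain ⟨k, rfl⟩ : ∃ j, k = j + 1 := ⟨k - 1, by omega⟩
    have h := hcoeff k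
    rw [Multiset.sum_eq_zero] at h
    · exact (mul_eq_zero.mp h).resolve_right (Nat.cast_add_one_ne_zero k)
    · intro x hx
      obtain ⟨c, hc, rfl⟩ := Multiset.mem_map.mp hx
      have := hlt c hc
      rw [Polynomial.coeff_eq_zero_of_natDegree_lt (((ihF c.1 (hlt c hc)).1).trans_lt (by omega)),
        mul_zero]
  · obtain ⟨F, rfl⟩ : ∃ F, T = graft F := by
      induction T using Tree.induct with
      | h F _ => exact ⟨F, rfl⟩
    classical
    -- The summand for the top coefficient, supported on cuts that leave only the root. It is
    -- multiplicative, so the sum over cuts factors over the children.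
    let f : Forest × Forest → K := fun c =>
      if c.2 = 0 then a ^ c.1.size * (((c.1.map Tree.factorial).prod : ℕ) : K)⁻¹ else 0
    have hsum : ((graft F).cuts.map fun c =>
        derivZero K (φ (ofTree K c.2)) * (φ (ofForest K c.1)).coeff F.size).sum =
        a * (a ^ F.size * (((F.map Tree.factorial).prod : ℕ) : K)⁻¹) := by
      have h1 : ((graft F).cuts.map fun c =>
          derivZero K (φ (ofTree K c.2)) * (φ (ofForest K c.1)).coeff F.size) =
          (Multiset.Sections (F.map Tree.branches)).map fun s =>
            a * f ((s.map Prod.fst).sum, (s.map Prod.snd).sum) := by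
        have hlt' := hlt
        have hsz := Tree.size_cuts (graft F)
        rw [Tree.cuts_graft_eq] at hlt' hsz ⊢
        rw [Multiset.map_map]
        refine Multiset.map_congr rfl fun s hs => ?_
        have hs1 := hlt' _ (Multiset.mem_map_of_mem _ hs)
        have hs2 := hsz _ (Multiset.mem_map_of_mem _ hs)
        simp only [Tree.size_graft_eq] at hs1 hs2
        obtain ⟨hd, hc⟩ := ihF _ (by simpa only [Tree.size_graft_eq] using hs1)
        simp only [Function.comp_apply, f]
        split_ifs with h0
        · rw [h0] at hs2 ⊢
          rw [Forest.size_zero] at hs2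
          rw [show F.size = Forest.size (s.map Prod.fst).sum by omega, hc, ha,
            derivZero_eq_coeff, bullet]
        · have : Forest.size (s.map Prod.snd).sum ≠ 0 := fun h => h0 (Forest.eq_zero_of_size h)
          rw [Polynomial.coeff_eq_zero_of_natDegree_lt (hd.trans_lt (by omega))]
          simp
      have h0 : f 0 = 1 := by simp [f]
      have hadd : ∀ c d, f (c + d) = f c * f d := by
        intro c d
        simp only [f, Prod.fst_add, Prod.snd_add, Forest.size_add, Multiset.map_add,
          Multiset.prod_add, Nat.cast_mul, mul_inv, pow_add, add_eq_zero]
        by_cases hc : c.2 = 0 <;> by_cases hd : d.2 = 0 <;> simp [hc, hd]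
        ring
      rw [h1, Multiset.sum_map_mul_left, Tree.sum_sections_branches f h0 hadd]
      congr 1
      have h2 : ∀ T : Tree, (T.branches.map f).sum = a ^ T.size * (T.factorial : K)⁻¹ := by
        intro T
        simp [Tree.branches, f, Forest.size_singleton]
      simp only [h2]
      clear * -
      induction F using Multiset.induction_on with
      | empty => simp
      | cons T F ih =>
        rw [Multiset.map_cons, Multiset.prod_cons, ih, Forest.size_cons, Multiset.map_cons,
          Multiset.prod_cons, Nat.cast_mul, mul_inv, pow_add]
        ring
    have h := (hcoeff F.size).trans hsum
    rw [Tree.factorial_graft, Tree.size_graft_eq, add_comm 1, pow_succ, Nat.cast_mul, mul_inv]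
    have hne : ((F.size : K) + 1) ≠ 0 := Nat.cast_add_one_ne_zero _
    rw [eq_div_of_mul_eq hne h]
    push_cast
    field_simp

theorem natDegree_le_and_coeff_of_mem_span [CharZero K] {φ : HCK K →ₐ[K] K[X]}
    (hφ : IsFeynmanRules φ) {n : ℕ} {x : HCK K}
    (hx : x ∈ Submodule.span K (ofTree K '' {T | T.size = n})) :
    (φ x).natDegree ≤ n ∧
      (φ x).coeff n = (φ (ofTree K bullet)).coeff 1 ^ n * invFactorial K x := by
  induction hx using Submodule.span_induction with
  | mem x hx =>
    obtain ⟨T, rfl, rfl⟩ := hx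
    simpa [invFactorial, ofTree] using natDegree_le_and_coeff_ofTree hφ T
  | zero => simp
  | add x y _ _ hx hy =>
    rw [map_add, map_add, mul_add, Polynomial.coeff_add, hx.2, hy.2]
    exact ⟨Polynomial.natDegree_add_le_of_degree_le hx.1 hy.1, rfl⟩
  | smul r x _ hx =>
    rw [map_smul, map_smul, Polynomial.coeff_smul, hx.2]
    exact ⟨(Polynomial.natDegree_smul_le r _).trans hx.1, by simp only [smul_eq_mul]; ring⟩

theorem degree_generator [CharZero K] {φ : HCK K →ₐ[K] K[X]} (hφ : IsFeynmanRules φ)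
    {t : ℕ → HCK K} (ht : GeneratesHopfSubalgebra t)
    (ha : (φ (ofTree K bullet)).coeff 1 ≠ 0) (hinv : ∀ n, 1 ≤ n → invFactorial K (t n) ≠ 0)
    (n : ℕ) : (φ (t n)).degree = n := by
  rcases Nat.eq_zero_or_pos n with rfl | hn
  · simp [ht.zero]
  obtain ⟨h1, h2⟩ := natDegree_le_and_coeff_of_mem_span hφ (ht.mem_span n hn)
  exact Polynomial.degree_eq_of_le_of_coeff_ne_zero (Polynomial.natDegree_le_iff_degree_le.mp h1)
    (by rw [h2]; exact mul_ne_zero (pow_ne_zero _ ha) (hinv n hn))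

theorem linearIndependent_generators [CharZero K] {φ : HCK K →ₐ[K] K[X]} (hφ : IsFeynmanRules φ)
    {t : ℕ → HCK K} (ht : GeneratesHopfSubalgebra t)
    (ha : (φ (ofTree K bullet)).coeff 1 ≠ 0) (hinv : ∀ n, 1 ≤ n → invFactorial K (t n) ≠ 0) :
    LinearIndependent K fun n => φ (t n) :=
  Polynomial.Sequence.linearIndependent
    (⟨fun n => φ (t n), degree_generator hφ ht ha hinv⟩ : Polynomial.Sequence K)

/-! ### Differential operators and their action on coefficients -/

/-- The coefficient of `xⁿ` in the image of `xⁱ` under the differential operator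
`∑_{j ≤ m} b j ∂ʲ`. -/
noncomputable def opCoeff (m : ℕ) (b : ℕ → PowerSeries K) (n i : ℕ) : K :=
  ∑ j ∈ Finset.range (m + 1),
    if i ≤ n + j then PowerSeries.coeff (n + j - i) (b j) * (i.descFactorial j : K) else 0

theorem coeff_constL_mul_dx_iterate (b : PowerSeries K) (G : PowerSeries K[X]) {j m : ℕ}
    (hj : j ≤ m) (n : ℕ) :
    PowerSeries.coeff n (constL b * dx^[j] G) =
      ∑ i ∈ Finset.range (n + m + 1),
        (if i ≤ n + j then PowerSeries.coeff (n + j - i) b * (i.descFactorial j : K) else 0) •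
          PowerSeries.coeff i G := by
  have hdx : (dx : PowerSeries K[X] → PowerSeries K[X]) = ⇑(PowerSeries.derivative K[X]) := rfl
  rw [PowerSeries.coeff_mul, ← Finset.Nat.sum_antidiagonal_swap,
    Finset.Nat.sum_antidiagonal_eq_sum_range_succ_mk]
  symm
  -- The range is padded to be common to all `j ≤ m`: columns beyond `n + j` are removed by the
  -- guard, columns below `j` by the vanishing falling factorial.
  rw [← Finset.sum_subset (Finset.range_subset_range.mpr (show j + (n + 1) ≤ n + m + 1 by omega)),
    Finset.sum_range_add, Finset.sum_eq_zero, zero_add]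
  · refine Finset.sum_congr rfl fun l hl => ?_
    have hl := Finset.mem_range.mp hl
    rw [if_pos (by omega), hdx]
    simp only [Prod.swap_prod_mk, constL, PowerSeries.coeff_map,
      PowerSeries.coeff_iterate_derivative]
    rw [show n + j - (j + l) = n - l by omega, Nat.add_comm j l,
      Nat.add_descFactorial_eq_ascFactorial,
      Polynomial.smul_eq_C_mul, Polynomial.C_mul, mul_assoc]
    simp
  · intro i hi
    rw [Nat.descFactorial_of_lt (Finset.mem_range.mp hi)]
    simp
  · intro i _ hi
    rw [if_neg (by simp at hi; omega), zero_smul]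

theorem coeff_applyOp {β : Polynomial (PowerSeries K)} {m : ℕ} (hβ : β.natDegree ≤ m)
    (G : PowerSeries K[X]) (n : ℕ) :
    PowerSeries.coeff n (applyOp β G) =
      ∑ i ∈ Finset.range (n + m + 1), opCoeff m β.coeff n i • PowerSeries.coeff i G := by
  rw [applyOp, Polynomial.sum_over_range' β (fun _ => by simp [constL]) (m + 1) (by omega),
    map_sum]
  simp only [opCoeff, Finset.sum_smul]
  rw [Finset.sum_comm]
  exact Finset.sum_congr rfl fun j hj => coeff_constL_mul_dx_iterate _ _
    (Nat.le_of_lt_succ (Finset.mem_range.mp hj)) n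

/-! ### The basis of falling factorials -/

/-- The polynomial `∑_{j ≤ m} b j X (X - 1) ⋯ (X - j + 1)`. -/
noncomputable def fallingSum (m : ℕ) (b : ℕ → K) : K[X] :=
  ∑ j ∈ Finset.range (m + 1), Polynomial.C (b j) * descPochhammer K j

theorem eval_fallingSum (m : ℕ) (b : ℕ → K) (i : ℕ) :
    (fallingSum m b).eval (i : K) = ∑ j ∈ Finset.range (m + 1), b j * (i.descFactorial j : K) := by
  simp [fallingSum, Polynomial.eval_finsetSum, descPochhammer_eval_eq_descFactorial]

theorem degree_descPochhammer (j : ℕ) : (descPochhammer K j).degree = j := by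
  rw [Polynomial.degree_eq_natDegree (monic_descPochhammer K j).ne_zero, descPochhammer_natDegree]

theorem degree_fallingSum_le (m : ℕ) (b : ℕ → K) : (fallingSum m b).degree ≤ m := by
  refine (Polynomial.degree_sum_le _ _).trans (Finset.sup_le fun j hj => ?_)
  rw [← Polynomial.smul_eq_C_mul]
  refine (Polynomial.degree_smul_le _ _).trans ?_
  rw [degree_descPochhammer]
  exact_mod_cast Nat.le_of_lt_succ (Finset.mem_range.mp hj)

theorem coeff_fallingSum (m : ℕ) (b : ℕ → K) : (fallingSum m b).coeff m = b m := by
  rw [fallingSum, Finset.sum_range_succ, Polynomial.coeff_add, Polynomial.finsetSum_coeff,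
    Finset.sum_eq_zero, zero_add, Polynomial.coeff_C_mul]
  · have h := (monic_descPochhammer K m).coeff_natDegree
    rw [descPochhammer_natDegree] at h
    rw [h, mul_one]
  · intro j hj
    rw [Polynomial.coeff_C_mul, Polynomial.coeff_eq_zero_of_degree_lt, mul_zero]
    rw [degree_descPochhammer]
    exact_mod_cast Finset.mem_range.mp hj

theorem degree_fallingSum_eq_iff (m : ℕ) (b : ℕ → K) :
    (fallingSum m b).degree = m ↔ b m ≠ 0 := by
  rw [← coeff_fallingSum m b]
  refine ⟨fun h => ?_, fun h => Polynomial.degree_eq_of_le_of_coeff_ne_zero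
    (degree_fallingSum_le m b) h⟩
  exact Polynomial.coeff_ne_zero_of_eq_degree h

theorem exists_eq_fallingSum (m : ℕ) (p : K[X]) (hp : p.degree ≤ m) :
    ∃ b : ℕ → K, p = fallingSum m b := by
  induction m generalizing p with
  | zero =>
    refine ⟨fun _ => p.coeff 0, ?_⟩
    rw [Polynomial.eq_C_of_degree_le_zero hp]
    simp [fallingSum]
  | succ m ih =>
    have h : (p - Polynomial.C (p.coeff (m + 1)) * descPochhammer K (m + 1)).degree ≤ m := by
      rw [Polynomial.degree_le_iff_coeff_zero]
      intro k hk
      have hk : m < k := by exact_mod_cast hk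
      rw [Polynomial.coeff_sub, Polynomial.coeff_C_mul]
      rcases (Nat.succ_le_of_lt hk).eq_or_lt with rfl | hk
      · have h := (monic_descPochhammer K (m + 1)).coeff_natDegree
        rw [descPochhammer_natDegree] at h
        rw [h, mul_one, sub_self]
      · rw [Polynomial.coeff_eq_zero_of_degree_lt (hp.trans_lt (by exact_mod_cast hk)),
          Polynomial.coeff_eq_zero_of_degree_lt (p := descPochhammer K (m + 1))
            (by rw [degree_descPochhammer]; exact_mod_cast hk)]
        simp
    obtain ⟨b, hb⟩ := ih _ h
    refine ⟨Function.update b (m + 1) (p.coeff (m + 1)), ?_⟩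
    rw [fallingSum, Finset.sum_range_succ, Function.update_self, ← sub_eq_iff_eq_add, hb,
      fallingSum]
    refine Finset.sum_congr rfl fun j hj => ?_
    rw [Function.update_of_ne (Finset.mem_range.mp hj).ne]

theorem fallingSum_eq_zero [CharZero K] {m d : ℕ} {b : ℕ → K}
    (h : ∀ i : ℕ, 1 ≤ i → d ≤ i → (fallingSum m b).eval (i : K) = 0) : fallingSum m b = 0 := by
  refine Polynomial.eq_zero_of_infinite_isRoot _ ?_
  refine Set.infinite_of_injective_forall_mem (f := fun i : ℕ => ((i + d + 1 : ℕ) : K)) ?_ ?_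
  · intro i j hij
    have := Nat.cast_injective hij
    omega
  · exact fun i => h _ (by omega) (by omega)

/-! ### Renormalization group equations and diagonals -/

section

variable {φ : HCK K →ₐ[K] K[X]} {t : ℕ → HCK K} {c : ℕ → ℕ → K} {m : ℕ}

theorem satisfiesRGE_of_diagonalsPolynomial (h0 : t 0 = 1)
    (hder : ∀ n, (φ (t n)).derivative = ∑ i ∈ Finset.range n, c n i • φ (t i))
    (h : DiagonalsPolynomial m c) : SatisfiesRGE m (greenFunction φ t) := by
  obtain ⟨p, hp, k, hk, hpk⟩ := h
  have hex : ∀ k, ∃ b : ℕ → K, 1 ≤ k → p k = fallingSum m b := by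
    intro k
    by_cases hk : 1 ≤ k
    · obtain ⟨b, hb⟩ := exists_eq_fallingSum m (p k) (hp k hk).1
      exact ⟨b, fun _ => hb⟩
    · exact ⟨0, fun h => absurd h hk⟩
  choose b hb using hex
  -- The coefficient of `xˡ` in `β⁽ʲ⁾` acts on the diagonal `n - i = l - j`, so it must be the
  -- `j`-th falling factorial coordinate of `p_{l-j}`, and zero on diagonals `≤ 0`.
  let B : ℕ → PowerSeries K := fun j => PowerSeries.mk fun l => if l ≤ j then 0 else b (l - j) j
  let β : Polynomial (PowerSeries K) :=
    ∑ j ∈ Finset.range (m + 1), Polynomial.monomial j (B j)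
  have hβ : ∀ j, β.coeff j = if j ≤ m then B j else 0 := by
    intro j
    simp [β, Polynomial.coeff_monomial]
  have hdeg : β.natDegree ≤ m := by
    rw [Polynomial.natDegree_le_iff_coeff_eq_zero]
    intro j hj
    rw [hβ, if_neg (by omega)]
  have hB : ∀ j n i, i ≤ n + j → PowerSeries.coeff (n + j - i) (B j) =
      if i < n then b (n - i) j else 0 := by
    intro j n i hi
    simp only [B, PowerSeries.coeff_mk]
    by_cases hin : i < n
    · rw [if_pos hin, if_neg (by omega), show n + j - i - j = n - i by omega]
    · rw [if_neg hin, if_pos (by omega)]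
  have hop : ∀ n i, opCoeff m β.coeff n i = if i < n then (p (n - i)).eval (i : K) else 0 := by
    intro n i
    rw [opCoeff]
    split_ifs with hin
    · rw [hb (n - i) (by omega), eval_fallingSum]
      refine Finset.sum_congr rfl fun j hj => ?_
      rw [if_pos (by omega), hβ, if_pos (Nat.le_of_lt_succ (Finset.mem_range.mp hj)),
        hB j n i (by omega), if_pos hin]
    · refine Finset.sum_eq_zero fun j hj => ?_
      split_ifs with hi
      · rw [hβ, if_pos (Nat.le_of_lt_succ (Finset.mem_range.mp hj)), hB j n i hi, if_neg hin,
          zero_mul]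
      · rfl
  -- `p n` need not give `c n 0`; since `φ(t₀) = 1`, the discrepancy is constant in `L` and goes
  -- into `γ₀`. The value at `n = 0` is set apart because `p 0` is unconstrained.
  refine ⟨β, PowerSeries.mk fun n => if n = 0 then 0 else c n 0 - (p n).eval 0, ?_, ?_⟩
  · refine Polynomial.degree_eq_of_le_of_coeff_ne_zero
      (Polynomial.natDegree_le_iff_degree_le.mp hdeg) fun h => ?_
    rw [hβ, if_pos le_rfl] at h
    have h1 := congrArg (PowerSeries.coeff (k + m - 0)) h
    rw [hB m k 0 (by omega), if_pos (by omega), Nat.sub_zero, map_zero] at h1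
    rw [hb k hk, degree_fallingSum_eq_iff] at hpk
    exact hpk h1
  · ext1 n
    rw [map_add, coeff_applyOp hdeg]
    simp only [dL, greenFunction, PowerSeries.coeff_mk, constL, PowerSeries.coeff_map]
    rw [hder, ← Finset.sum_subset (Finset.range_subset_range.mpr (show n ≤ n + m + 1 by omega))]
    · rcases n with _ | n
      · simp
      rw [Finset.sum_range_succ', Finset.sum_range_succ' (fun i => opCoeff _ _ _ _ • _), add_assoc]
      congr 1
      · refine Finset.sum_congr rfl fun i hi => ?_
        have hi := Finset.mem_range.mp hi
        rw [hop, if_pos (by omega), ← (hp (n + 1 - (i + 1)) (by omega)).2 (i + 1) (by omega),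
          show n + 1 - (i + 1) + (i + 1) = n + 1 by omega]
      · rw [hop, if_pos (by omega), if_neg (by omega), h0, map_one, Nat.sub_zero, Nat.cast_zero,
          Polynomial.smul_eq_C_mul, Polynomial.smul_eq_C_mul, Polynomial.C_sub]
        ring
    · intro i _ hi
      rw [hop, if_neg (by simpa using hi), zero_smul]

theorem opCoeff_eq_of_applyOp (h0 : t 0 = 1)
    (hder : ∀ n, (φ (t n)).derivative = ∑ i ∈ Finset.range n, c n i • φ (t i))
    (hli : LinearIndependent K fun n => φ (t n))
    {β : Polynomial (PowerSeries K)} (hβ : β.natDegree ≤ m) {γ : PowerSeries K}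
    (h : dL (greenFunction φ t) = applyOp β (greenFunction φ t) + constL γ)
    {n i : ℕ} (hi : 1 ≤ i) (him : i ≤ n + m) :
    opCoeff m β.coeff n i = if i < n then c n i else 0 := by
  have h1 := congrArg (PowerSeries.coeff n) h
  rw [map_add, coeff_applyOp hβ] at h1
  simp only [dL, greenFunction, PowerSeries.coeff_mk, constL, PowerSeries.coeff_map] at h1
  -- A single linear relation among the `φ(tⱼ)`; the inhomogeneity enters only at index `0`, so all
  -- columns `i ≥ 1` can be compared.
  have h2 : ∑ j ∈ Finset.range (n + m + 1),
      (opCoeff m β.coeff n j - (if j < n then c n j else 0) +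
        if j = 0 then PowerSeries.coeff n γ else 0) • φ (t j) = 0 := by
    have h3 : ∑ j ∈ Finset.range (n + m + 1), (if j < n then c n j else 0) • φ (t j) =
        (φ (t n)).derivative := by
      rw [hder, ← Finset.sum_subset (Finset.range_subset_range.mpr (show n ≤ n + m + 1 by omega))]
      · exact Finset.sum_congr rfl fun j hj => by rw [if_pos (Finset.mem_range.mp hj)]
      · intro j _ hj
        rw [if_neg (by simpa using hj), zero_smul]
    simp only [add_smul, sub_smul, Finset.sum_add_distrib, Finset.sum_sub_distrib]
    rw [h3, h1]
    simp [h0, ite_smul, Polynomial.smul_eq_C_mul]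
  have h3 := linearIndependent_iff'.mp hli _ _ h2 i (Finset.mem_range.mpr (by omega))
  rw [if_neg (show i ≠ 0 by omega), add_zero] at h3
  exact sub_eq_zero.mp h3

theorem diagonalsPolynomial_of_satisfiesRGE [CharZero K] (h0 : t 0 = 1)
    (hder : ∀ n, (φ (t n)).derivative = ∑ i ∈ Finset.range n, c n i • φ (t i))
    (hli : LinearIndependent K fun n => φ (t n))
    (h : SatisfiesRGE m (greenFunction φ t)) : DiagonalsPolynomial m c := by
  obtain ⟨β, γ, hdeg, h⟩ := h
  have hβ : β.natDegree ≤ m := Polynomial.natDegree_le_iff_degree_le.mpr hdeg.le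
  have hop := fun n i => opCoeff_eq_of_applyOp (n := n) (i := i) h0 hder hli hβ h
  refine ⟨fun k => fallingSum m fun j => PowerSeries.coeff (k + j) (β.coeff j),
    fun k hk => ⟨degree_fallingSum_le _ _, fun i hi => ?_⟩, ?_⟩
  · have := hop (k + i) i hi (by omega)
    rw [if_pos (by omega)] at this
    rw [← this, eval_fallingSum, opCoeff]
    refine Finset.sum_congr rfl fun j _ => ?_
    rw [if_pos (by omega), show k + i + j - i = k + j by omega]
  -- On the diagonal `n - i = -d` the operator matrix vanishes at infinitely many `i`, so its
  -- polynomial is zero. Its coefficient at `iᵐ` is that of `x^(m-d)` in `β⁽ᵐ⁾`.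
  · have hsmall : ∀ d, d ≤ m → PowerSeries.coeff (m - d) (β.coeff m) = 0 := by
      intro d hd
      have hz : fallingSum m
          (fun j => if d ≤ j then PowerSeries.coeff (j - d) (β.coeff j) else 0) = 0 := by
        refine fallingSum_eq_zero (d := d) fun i hi hdi => ?_
        have := hop (i - d) i hi (by omega)
        rw [if_neg (by omega)] at this
        rw [eval_fallingSum]
        refine Eq.trans ?_ this
        refine Finset.sum_congr rfl fun j _ => ?_
        by_cases hj : d ≤ j
        · rw [if_pos hj, if_pos (by omega), show i - d + j - i = j - d by omega]
        · rw [if_neg hj, if_neg (by omega), zero_mul]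
      have := coeff_fallingSum m
        (fun j => if d ≤ j then PowerSeries.coeff (j - d) (β.coeff j) else 0)
      rw [hz, Polynomial.coeff_zero, if_pos hd] at this
      exact this.symm
    -- If no diagonal `k ≥ 1` had degree `m`, the coefficients of `β⁽ᵐ⁾` above index `m` would
    -- vanish too, contradicting the order of the operator.
    by_contra hcon
    push Not at hcon
    refine Polynomial.coeff_ne_zero_of_eq_degree hdeg (PowerSeries.ext fun l => ?_)
    rw [map_zero]
    rcases Nat.lt_or_ge m l with hl | hl
    · have := hcon (l - m) (by omega)
      rw [Ne, degree_fallingSum_eq_iff, not_not, Nat.sub_add_cancel hl.le] at this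
      exact this
    · have := hsmall (m - l) (by omega)
      rwa [Nat.sub_sub_self hl] at this

end

end ConnesKreimer

open ConnesKreimer in
theorem mainTheorem10 {K : Type*} [Field K] [CharZero K]
    (φ : HCK K →ₐ[K] K[X]) (hφ : IsFeynmanRules φ)
    (t : ℕ → HCK K) (ht : GeneratesHopfSubalgebra t) :
    (∃ τ : ℕ → ℕ → HCK K, IsCoproductArray t τ) ∧
    ∀ τ : ℕ → ℕ → HCK K, IsCoproductArray t τ → ∀ m : ℕ,
      (DiagonalsPolynomial m (coeffC φ τ) → SatisfiesRGE m (greenFunction φ t)) ∧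
      ((φ (ofTree K bullet)).coeff 1 ≠ 0 → (∀ n, 1 ≤ n → invFactorial K (t n) ≠ 0) →
        (SatisfiesRGE m (greenFunction φ t) ↔ DiagonalsPolynomial m (coeffC φ τ))) := by
  refine ⟨ht.exists_isCoproductArray, fun τ hτ m => ?_⟩
  have hder : ∀ n, (φ (t n)).derivative = ∑ i ∈ Finset.range n, coeffC φ τ n i • φ (t i) := by
    intro n
    rw [hφ.derivative_of_isCoproductArray hτ, Finset.sum_range_succ, ht.coeffC_self hφ hτ,
      zero_smul, add_zero]
  exact ⟨satisfiesRGE_of_diagonalsPolynomial ht.zero hder, fun ha hinv =>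
    ⟨diagonalsPolynomial_of_satisfiesRGE ht.zero hder
      (linearIndependent_generators hφ ht ha hinv),
      satisfiesRGE_of_diagonalsPolynomial ht.zero hder⟩⟩
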